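/- Consider the perturbed double pendulum \[ \theta_1''=-2\theta_1+\theta_2+\varepsilon F_1(\tau,\theta_1,\theta_1',\theta_2,\theta_2'),\qquad \theta_2''=2\theta_1-2\theta_2+\varepsilon F_2(\tau,\theta_1,\theta_1',\theta_2,\theta_2'), \] where the prime denotes the derivative with respect to the time $\tau$ and \[ F_1=\theta_2'+\theta_1^2\cos\!\left(\sqrt{2+\sqrt2}\,\tau\right),\qquad F_2=0 . \] Put $T_2=2\pi/\sqrt{2+\sqrt2}$ and $(Z_0^*,W_0^*)=\left(0,-8(2+\sqrt2)\right)$. Then \[ \bar\theta_1(\tau)=-\frac{1}{\sqrt{4+2\sqrt2}}\left(Z_0^*\cos\!\left(\sqrt{2+\sqrt2}\,\tau\right)+W_0^*\sin\!\left(\sqrt{2+\sqrt2}\,\tau\right)\right), \] \[ \bar\theta_2(\tau)=\frac{1}{\sqrt{2+\sqrt2}}\left(Z_0^*\cos\!\left(\sqrt{2+\sqrt2}\,\tau\right)+W_0^*\sin\!\left(\sqrt{2+\sqrt2}\,\tau\right)\right) \] is a $T_2$-periodic solution of the unperturbed system ($\varepsilon=0$), and there is $\varepsilon_0>0$ such that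 for every $\varepsilon$ with $0<|\varepsilon|<\varepsilon_0$ the perturbed system has a $T_2$-periodic solution $(\theta_1(\tau,\varepsilon),\theta_2(\tau,\varepsilon))$, defined for all $\tau\in\mathbb R$, such that, as $\varepsilon\to0$, $(\theta_1,\theta_1',\theta_2,\theta_2')(\tau,\varepsilon)$ tends to $(\bar\theta_1,\bar\theta_1',\bar\theta_2,\bar\theta_2')(\tau)$ uniformly in $\tau\in\mathbb R$. -/

import Mathlib

open scoped Topology

namespace DoublePendulum

/-- `(θ₁, θ₂)` is a solution, defined for all times, of the perturbed double pendulum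
`θ₁'' = -2 θ₁ + θ₂ + ε F₁(τ, θ₁, θ₁', θ₂, θ₂')`,
`θ₂'' = 2 θ₁ - 2 θ₂ + ε F₂(τ, θ₁, θ₁', θ₂, θ₂')`.
For `ε = 0` this is the unperturbed double pendulum. -/
def IsSolution (F₁ F₂ : ℝ → ℝ → ℝ → ℝ → ℝ → ℝ) (ε : ℝ) (θ₁ θ₂ : ℝ → ℝ) : Prop :=
  Differentiable ℝ θ₁ ∧ Differentiable ℝ θ₂ ∧
    (∀ τ, HasDerivAt (deriv θ₁)
      (-2 * θ₁ τ + θ₂ τ + ε * F₁ τ (θ₁ τ) (deriv θ₁ τ) (θ₂ τ) (deriv θ₂ τ)) τ) ∧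
    (∀ τ, HasDerivAt (deriv θ₂)
      (2 * θ₁ τ - 2 * θ₂ τ + ε * F₂ τ (θ₁ τ) (deriv θ₁ τ) (θ₂ τ) (deriv θ₂ τ)) τ)

/-- The larger frequency `√(2 + √2)` of the unperturbed double pendulum. -/
noncomputable def fastFreq : ℝ := √(2 + √2)

/-- The period `T₂ = 2π / √(2 + √2)` of the fast mode. -/
noncomputable def fastPeriod : ℝ := 2 * Real.pi / fastFreq

/-- First angle of the fast-mode orbit with parameters `(Z₀, W₀)`. -/
noncomputable def fastOrbit₁ (Z₀ W₀ τ : ℝ) : ℝ :=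
  -(1 / √(4 + 2 * √2)) * (Z₀ * Real.cos (fastFreq * τ) + W₀ * Real.sin (fastFreq * τ))

/-- Second angle of the fast-mode orbit with parameters `(Z₀, W₀)`. -/
noncomputable def fastOrbit₂ (Z₀ W₀ τ : ℝ) : ℝ :=
  1 / √(2 + √2) * (Z₀ * Real.cos (fastFreq * τ) + W₀ * Real.sin (fastFreq * τ))

/-- The perturbation `F₁ = θ₂' + θ₁² cos(√(2 + √2) τ)`; the arguments are, in this order,
the time, `θ₁`, `θ₁'`, `θ₂`, `θ₂'`. -/
noncomputable def pertF₁ (τ θ₁ _θ₁' _θ₂ θ₂' : ℝ) : ℝ :=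
  θ₂' + θ₁ ^ 2 * Real.cos (√(2 + √2) * τ)

/-- The perturbation `F₂ = 0`. -/
def pertF₂ (_τ _θ₁ _θ₁' _θ₂ _θ₂' : ℝ) : ℝ := 0

end DoublePendulum

open scoped Topology

namespace DoublePendulum

open Filter Set

/-! With `u = √2 θ₁ - θ₂`, `v = √2 θ₁ + θ₂`, `z = u' + i ω u`, `y = v' + i μ v`, the system becomes
`z' = i ω z + ε f`, `y' = i μ y + ε f` with one real forcing `f`, where `ω > μ` are the two
frequencies. Since `ω T₂ = 2π`, the fast equation is resonant: `z` is periodic iff the Fourier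
integral of `f` along `exp (-i ω s)` vanishes. Since `0 < μ < ω`, the slow equation has a unique
periodic response.

Periodic solutions are thus solutions of `x = P c + ε Q (N x)`, `R (N x) = 0` in `C([0, T₂])²`, with
unknowns the fast amplitude `c` and the state `x`. The implicit function theorem at `ε = 0` gives a
branch as soon as the averaged function `c ↦ R (N (P c))` has a zero with invertible derivative
(`exists_branch_of_bijective_average`). The amplitude `16 ω²` is such a zero
(`endpointCLM_forcingMap_limit`, `bijective_average`). Convergence in the sup norm of the modal
state gives uniform convergence of angles and velocities. -/

theorem exists_implicit {E₁ E₂ F : Type*}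
    [NormedAddCommGroup E₁] [NormedSpace ℝ E₁] [CompleteSpace E₁]
    [NormedAddCommGroup E₂] [NormedSpace ℝ E₂] [CompleteSpace E₂]
    [NormedAddCommGroup F] [NormedSpace ℝ F] [CompleteSpace F]
    {f : E₁ × E₂ → F} {L : E₁ × E₂ →L[ℝ] F} {u : E₁} {v : E₂} (hf : HasStrictFDerivAt f L (u, v))
    (hL : (L.comp (ContinuousLinearMap.inr ℝ E₁ E₂)).IsInvertible) (h₀ : f (u, v) = 0) :
    ∃ ψ : E₁ → E₂, Tendsto ψ (𝓝 u) (𝓝 v) ∧ ∀ᶠ x in 𝓝 u, f (x, ψ x) = 0 :=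
  ⟨hf.implicitFunctionOfProdDomain hL, hf.tendsto_implicitFunctionOfProdDomain hL,
    h₀ ▸ hf.eventually_apply_implicitFunctionOfProdDomain hL⟩

/-! ### Lyapunov–Schmidt reduction in Banach spaces -/

theorem exists_branch_of_bijective_average {C S F : Type*}
    [NormedAddCommGroup C] [NormedSpace ℝ C] [CompleteSpace C]
    [NormedAddCommGroup S] [NormedSpace ℝ S] [CompleteSpace S]
    [NormedAddCommGroup F] [NormedSpace ℝ F]
    (P : C →L[ℝ] S) (Q : F →L[ℝ] S) (R : F →L[ℝ] C) {N : S → F} {N' : S →L[ℝ] F} {c₀ : C}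
    (hN : HasStrictFDerivAt N N' (P c₀)) (h₀ : R (N (P c₀)) = 0)
    (hJ : Function.Bijective (fun c => R (N' (P c)))) :
    ∃ (c : ℝ → C) (x : ℝ → S), Tendsto x (𝓝 0) (𝓝 (P c₀)) ∧
      ∀ᶠ ε in 𝓝 (0 : ℝ), x ε = P (c ε) + ε • Q (N (x ε)) ∧ R (N (x ε)) = 0 := by
  let snd2 := (ContinuousLinearMap.snd ℝ C S).comp (ContinuousLinearMap.snd ℝ ℝ (C × S))
  let fst2 := (ContinuousLinearMap.fst ℝ C S).comp (ContinuousLinearMap.snd ℝ ℝ (C × S))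
  have h2 : HasStrictFDerivAt (fun p : ℝ × (C × S) => p.2.2) snd2 ((0 : ℝ), (c₀, P c₀)) :=
    snd2.hasStrictFDerivAt
  have h1 : HasStrictFDerivAt (fun p : ℝ × (C × S) => P p.2.1) (P.comp fst2)
      ((0 : ℝ), (c₀, P c₀)) := (P.comp fst2).hasStrictFDerivAt
  have h0 : HasStrictFDerivAt (fun p : ℝ × (C × S) => p.1)
      (ContinuousLinearMap.fst ℝ ℝ (C × S)) ((0 : ℝ), (c₀, P c₀)) :=
    (ContinuousLinearMap.fst ℝ ℝ (C × S)).hasStrictFDerivAt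
  have hN2 : HasStrictFDerivAt (fun p : ℝ × (C × S) => N p.2.2) (N'.comp snd2)
      ((0 : ℝ), (c₀, P c₀)) :=
    HasStrictFDerivAt.comp ((0 : ℝ), (c₀, P c₀)) (g := N) hN h2
  have hQ : HasStrictFDerivAt (fun p : ℝ × (C × S) => Q (N p.2.2)) (Q.comp (N'.comp snd2))
      ((0 : ℝ), (c₀, P c₀)) :=
    HasStrictFDerivAt.comp ((0 : ℝ), (c₀, P c₀)) (g := Q) Q.hasStrictFDerivAt hN2
  have hR : HasStrictFDerivAt (fun p : ℝ × (C × S) => R (N p.2.2)) (R.comp (N'.comp snd2))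
      ((0 : ℝ), (c₀, P c₀)) :=
    HasStrictFDerivAt.comp ((0 : ℝ), (c₀, P c₀)) (g := R) R.hasStrictFDerivAt hN2
  have hΦ := ((h2.fun_sub h1).fun_sub (h0.fun_smul hQ)).prodMk hR
  -- At `ε = 0`, in directions that fix `ε`, the term `ε • Q (N x)` contributes nothing. The
  -- remaining derivative is block-eliminated by `s = P c`, which leaves the map of `hJ`.
  have key : ∀ L : ℝ × (C × S) →L[ℝ] S × C,
      (∀ c s, L (0, (c, s)) = (s - P c, R (N' s))) →
      (L.comp (ContinuousLinearMap.inr ℝ ℝ (C × S))).IsInvertible := by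
    intro L hL
    refine ⟨ContinuousLinearEquiv.ofBijective _ ?_ ?_, ContinuousLinearEquiv.coe_ofBijective _ _ _⟩
    · rw [LinearMap.ker_eq_bot']
      rintro ⟨c, s⟩ h
      have h' : L (0, (c, s)) = 0 := h
      rw [hL, Prod.mk_eq_zero, sub_eq_zero] at h'
      obtain ⟨rfl, h'⟩ := h'
      have : c = 0 := hJ.1 (by simpa using h')
      simp [this]
    · rw [LinearMap.range_eq_top]
      rintro ⟨s, r⟩
      obtain ⟨c, hc⟩ := hJ.2 (r - R (N' s))
      refine ⟨(c, s + P c), ?_⟩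
      change L (0, (c, s + P c)) = _
      rw [hL]
      simp only at hc
      simp [hc]
  obtain ⟨L, hL, hLe⟩ : ∃ L : ℝ × (C × S) →L[ℝ] S × C,
      HasStrictFDerivAt (fun p : ℝ × (C × S) =>
        (p.2.2 - P p.2.1 - p.1 • Q (N p.2.2), R (N p.2.2))) L (0, (c₀, P c₀)) ∧
      ∀ c s, L (0, (c, s)) = (s - P c, R (N' s)) :=
    ⟨_, hΦ, fun c s => by simp [snd2, fst2]⟩
  obtain ⟨ψ, hψ, hψe⟩ := exists_implicit hL (key L hLe) (by simp [h₀])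
  refine ⟨fun ε => (ψ ε).1, fun ε => (ψ ε).2, (continuous_snd.tendsto _).comp hψ, ?_⟩
  filter_upwards [hψe] with ε hε
  simp only [Prod.mk_eq_zero] at hε
  exact ⟨by rw [← sub_eq_zero, ← hε.1]; abel, hε.2⟩

/-! ### Variation of constants on one period -/

variable {T : ℝ}

/-- The primitive vanishing at `0`, as an operator on continuous functions on `[0, T]`. -/
noncomputable def primitiveCLM (hT : 0 ≤ T) : C(Icc 0 T, ℂ) →L[ℝ] C(Icc 0 T, ℂ) :=
  LinearMap.mkContinuous
    { toFun := fun F => ⟨fun t => ∫ s in (0 : ℝ)..t, F (projIcc 0 T hT s),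
        (intervalIntegral.continuous_primitive (fun a b =>
          (F.continuous.comp continuous_projIcc).intervalIntegrable a b) 0).comp
            continuous_subtype_val⟩
      map_add' := fun F G => by
        ext t
        exact intervalIntegral.integral_add
          ((F.continuous.comp continuous_projIcc).intervalIntegrable _ _)
          ((G.continuous.comp continuous_projIcc).intervalIntegrable _ _)
      map_smul' := fun r F => by
        ext t
        exact intervalIntegral.integral_smul r _ }
    T (fun F => by
      refine (ContinuousMap.norm_le _ (by positivity)).2 fun t => ?_
      refine (intervalIntegral.norm_integral_le_of_norm_le_const
        (fun s _ => F.norm_coe_le_norm (projIcc 0 T hT s))).trans ?_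
      rw [sub_zero, abs_of_nonneg t.2.1, mul_comm]
      exact mul_le_mul_of_nonneg_right t.2.2 (norm_nonneg _))

theorem primitiveCLM_apply (hT : 0 ≤ T) (F : C(Icc 0 T, ℂ)) (t : Icc 0 T) :
    primitiveCLM hT F t = ∫ s in (0 : ℝ)..t, F (projIcc 0 T hT s) := rfl

/-- The function `t ↦ exp (l t)` on `[0, T]`. -/
noncomputable def expMap (T : ℝ) (l : ℂ) : C(Icc 0 T, ℂ) :=
  ⟨fun t => Complex.exp (l * (t : ℝ)), by fun_prop⟩

/-- The operator sending `F` to the solution of `z' = l z + F`, `z 0 = 0` on `[0, T]`. -/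
noncomputable def duhamelCLM (hT : 0 ≤ T) (l : ℂ) : C(Icc 0 T, ℂ) →L[ℝ] C(Icc 0 T, ℂ) :=
  (ContinuousLinearMap.mul ℝ _ (expMap T l)).comp
    ((primitiveCLM hT).comp (ContinuousLinearMap.mul ℝ _ (expMap T (-l))))

theorem duhamelCLM_apply (hT : 0 ≤ T) (l : ℂ) (F : C(Icc 0 T, ℂ)) (t : Icc 0 T) :
    duhamelCLM hT l F t = Complex.exp (l * (t : ℝ)) *
      ∫ s in (0 : ℝ)..t, Complex.exp (-l * s) * F (projIcc 0 T hT s) := by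
  change Complex.exp (l * (t : ℝ)) * primitiveCLM hT (expMap T (-l) * F) t = _
  rw [primitiveCLM_apply]
  congr 1
  refine intervalIntegral.integral_congr fun s hs => ?_
  rw [uIcc_of_le t.2.1] at hs
  change Complex.exp (-l * ((projIcc 0 T hT s : Icc 0 T) : ℝ)) * _ = _
  rw [projIcc_of_mem hT ⟨hs.1, hs.2.trans t.2.2⟩]

/-! ### Periodic extension of solutions -/

/-- The `T`-periodic extension of a function on `[0, T]`. -/
noncomputable def periodicExtension {E : Type*} (hT : 0 < T) (F : Icc 0 T → E) (t : ℝ) : E :=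
  F ⟨toIcoMod hT 0 t, Ico_subset_Icc_self (by simpa using toIcoMod_mem_Ico hT 0 t)⟩

theorem periodic_periodicExtension {E : Type*} (hT : 0 < T) (F : Icc 0 T → E) :
    Function.Periodic (periodicExtension hT F) T := fun t => by
  simp [periodicExtension]

theorem periodicExtension_of_mem_Ico {E : Type*} (hT : 0 < T) (F : Icc 0 T → E) {t : ℝ}
    (ht : t ∈ Ico 0 T) : periodicExtension hT F t = F ⟨t, Ico_subset_Icc_self ht⟩ := by
  have : toIcoMod hT 0 t = t := (toIcoMod_eq_self hT).2 (by simpa using ht)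
  simp [periodicExtension, this]

theorem periodicExtension_of_mem_Icc {E : Type*} (hT : 0 < T) (F : Icc 0 T → E)
    (hF : F ⟨0, left_mem_Icc.2 hT.le⟩ = F ⟨T, right_mem_Icc.2 hT.le⟩) {t : ℝ}
    (ht : t ∈ Icc 0 T) : periodicExtension hT F t = F ⟨t, ht⟩ := by
  rcases ht.2.lt_or_eq with h | rfl
  · exact periodicExtension_of_mem_Ico hT F ⟨ht.1, h⟩
  · rw [← hF, ← periodicExtension_of_mem_Ico hT F (left_mem_Ico.2 hT)]
    simpa using periodic_periodicExtension hT F 0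

theorem eq_of_periodic_of_eqOn_Ico {E : Type*} (hT : 0 < T) {f g : ℝ → E}
    (hf : Function.Periodic f T) (hg : Function.Periodic g T) (h : EqOn f g (Ico 0 T)) : f = g := by
  refine funext fun t => ?_
  have hm : toIcoMod hT 0 t ∈ Ico 0 T := by simpa using toIcoMod_mem_Ico hT 0 t
  have := h hm
  rwa [toIcoMod, hf.sub_zsmul_eq, hg.sub_zsmul_eq] at this

theorem continuous_periodicExtension {E : Type*} [TopologicalSpace E] (hT : 0 < T)
    (F : C(Icc 0 T, E))
    (hF : F ⟨0, left_mem_Icc.2 hT.le⟩ = F ⟨T, right_mem_Icc.2 hT.le⟩) :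
    Continuous (periodicExtension hT F) := by
  have : Fact (0 < T) := ⟨hT⟩
  have hext : periodicExtension hT F =
      fun t : ℝ => AddCircle.liftIco T 0 (fun s => F (projIcc 0 T hT.le s)) (t : AddCircle T) := by
    refine eq_of_periodic_of_eqOn_Ico hT (periodic_periodicExtension hT F) (fun t => by simp)
      fun t ht => ?_
    rw [periodicExtension_of_mem_Ico hT F ht, AddCircle.liftIco_zero_coe_apply ht,
      projIcc_of_mem hT.le (Ico_subset_Icc_self ht)]
  rw [hext]
  have hc : Continuous (AddCircle.liftIco T 0 (fun s => F (projIcc 0 T hT.le s))) :=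
    AddCircle.liftIco_zero_continuous (by simpa [projIcc_left, projIcc_right] using hF)
      (F.continuous.comp continuous_projIcc).continuousOn
  exact hc.comp (AddCircle.continuous_mk' T)

/-- Variation of constants, with initial value `c`. -/
noncomputable def duhamel (l c : ℂ) (G : ℝ → ℂ) (t : ℝ) : ℂ :=
  Complex.exp (l * t) * (c + ∫ s in (0 : ℝ)..t, Complex.exp (-l * s) * G s)

theorem hasDerivAt_duhamel (l c : ℂ) {G : ℝ → ℂ} (hG : Continuous G) (t : ℝ) :
    HasDerivAt (duhamel l c G) (l * duhamel l c G t + G t) t := by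
  have hi : Continuous fun s : ℝ => Complex.exp (-l * s) * G s := by fun_prop
  have h1 : HasDerivAt (fun u : ℝ => ∫ s in (0 : ℝ)..u, Complex.exp (-l * s) * G s)
      (Complex.exp (-l * t) * G t) t := hi.integral_hasStrictDerivAt 0 t |>.hasDerivAt
  have h2 : HasDerivAt (fun u : ℝ => Complex.exp (l * u)) (Complex.exp (l * t) * (l * 1)) t :=
    ((HasDerivAt.ofReal_comp (hasDerivAt_id t)).const_mul l).cexp
  refine (h2.mul (h1.const_add c)).congr_deriv ?_
  have h3 : Complex.exp (l * t) * Complex.exp (-l * t) = 1 := by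
    rw [← Complex.exp_add]; simp
  simp only [duhamel]
  linear_combination G t * h3

/-- The difference `z (t + T) - z t` solves the homogeneous equation, so its product with `exp (-l
t)` is constant, and it vanishes at `0`. -/
theorem periodic_of_hasDerivAt_linear {l : ℂ} {G z : ℝ → ℂ} (hG : Function.Periodic G T)
    (hz : ∀ t, HasDerivAt z (l * z t + G t) t) (h : z T = z 0) : Function.Periodic z T := by
  have hd : ∀ t : ℝ, HasDerivAt (fun t : ℝ => Complex.exp (-l * t) * (z (t + T) - z t)) 0 t := by
    intro t
    have h2 : HasDerivAt (fun u : ℝ => Complex.exp (-l * u)) (Complex.exp (-l * t) * (-l * 1)) t :=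
      ((HasDerivAt.ofReal_comp (hasDerivAt_id t)).const_mul (-l)).cexp
    refine (h2.mul (((hz (t + T)).comp_add_const t T).sub (hz t))).congr_deriv ?_
    simp only [hG t, Pi.sub_apply]
    ring
  intro t
  have hc := is_const_of_deriv_eq_zero (fun t => (hd t).differentiableAt)
    (fun t => (hd t).deriv) t 0
  simp only [zero_add, h, sub_self, mul_zero, mul_eq_zero, Complex.exp_ne_zero, false_or] at hc
  exact sub_eq_zero.1 hc

/-- Differentiability at multiples of `T` is the issue. The Duhamel formula on all of `ℝ` with the
extended forcing is differentiable and periodic, and it agrees with the extension on one period,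
hence everywhere. -/
theorem hasDerivAt_periodicExtension (hT : 0 < T) {l c : ℂ} {z G : C(Icc 0 T, ℂ)}
    (hz : z = c • expMap T l + duhamelCLM hT.le l G)
    (hzT : z ⟨0, left_mem_Icc.2 hT.le⟩ = z ⟨T, right_mem_Icc.2 hT.le⟩)
    (hGT : G ⟨0, left_mem_Icc.2 hT.le⟩ = G ⟨T, right_mem_Icc.2 hT.le⟩) (t : ℝ) :
    HasDerivAt (periodicExtension hT z)
      (l * periodicExtension hT z t + periodicExtension hT G t) t := by
  have hG := continuous_periodicExtension hT G hGT
  have hd := hasDerivAt_duhamel l c hG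
  have hI : ∀ s (hs : s ∈ Icc 0 T), duhamel l c (periodicExtension hT G) s = z ⟨s, hs⟩ := by
    intro s hs
    rw [hz, ContinuousMap.add_apply, duhamelCLM_apply, duhamel, mul_add]
    congr 1
    · exact mul_comm _ _
    · congr 1
      refine intervalIntegral.integral_congr fun r hr => ?_
      rw [uIcc_of_le hs.1] at hr
      have hr' : r ∈ Icc 0 T := ⟨hr.1, hr.2.trans hs.2⟩
      simp only [periodicExtension_of_mem_Icc hT G hGT hr', projIcc_of_mem hT.le hr']
  have hp : Function.Periodic (duhamel l c (periodicExtension hT G)) T :=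
    periodic_of_hasDerivAt_linear (periodic_periodicExtension hT G) hd
      (by rw [hI T (right_mem_Icc.2 hT.le), hI 0 (left_mem_Icc.2 hT.le), hzT])
  have he : periodicExtension hT z = duhamel l c (periodicExtension hT G) :=
    eq_of_periodic_of_eqOn_Ico hT (periodic_periodicExtension hT z) hp fun s hs => by
      rw [periodicExtension_of_mem_Ico hT z hs, hI s (Ico_subset_Icc_self hs)]
  rw [he]
  exact hd t

/-! ### Resonance operator and nonresonant periodic response -/

/-- Multiples of the exponential, as a real-linear operator. -/
noncomputable def modeCLM (T : ℝ) (l : ℂ) : ℂ →L[ℝ] C(Icc 0 T, ℂ) :=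
  (ContinuousLinearMap.toSpanSingleton ℂ (expMap T l)).restrictScalars ℝ

/-- The value at `T` of the solution of `z' = l z + F`, `z 0 = 0`. -/
noncomputable def endpointCLM (hT : 0 ≤ T) (l : ℂ) : C(Icc 0 T, ℂ) →L[ℝ] ℂ :=
  (ContinuousMap.evalCLM ℝ (⟨T, right_mem_Icc.2 hT⟩ : Icc 0 T)).comp (duhamelCLM hT l)

theorem endpointCLM_apply (hT : 0 ≤ T) (l : ℂ) (F : C(Icc 0 T, ℂ)) :
    endpointCLM hT l F = duhamelCLM hT l F ⟨T, right_mem_Icc.2 hT⟩ := rfl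

/-- The operator sending `F` to the solution of `z' = l z + F`, `z 0 = z T`, when `exp (l T) ≠ 1`. -/
noncomputable def periodicCLM (hT : 0 ≤ T) (l : ℂ) : C(Icc 0 T, ℂ) →L[ℝ] C(Icc 0 T, ℂ) :=
  (modeCLM T l).comp
    ((ContinuousLinearMap.mul ℝ ℂ (1 - Complex.exp (l * T))⁻¹).comp (endpointCLM hT l)) +
      duhamelCLM hT l

theorem periodicCLM_apply (hT : 0 ≤ T) (l : ℂ) (F : C(Icc 0 T, ℂ)) :
    periodicCLM hT l F = ((1 - Complex.exp (l * T))⁻¹ * endpointCLM hT l F) • expMap T l +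
      duhamelCLM hT l F := rfl

theorem duhamelCLM_left (hT : 0 ≤ T) (l : ℂ) (F : C(Icc 0 T, ℂ)) :
    duhamelCLM hT l F ⟨0, left_mem_Icc.2 hT⟩ = 0 := by
  simp [duhamelCLM_apply]

/-- The chosen initial value is the fixed point of the affine period map `c ↦ exp (l T) c +
endpointCLM hT l F`. -/
theorem periodicCLM_left_eq_right (hT : 0 ≤ T) {l : ℂ} (hl : Complex.exp (l * T) ≠ 1)
    (F : C(Icc 0 T, ℂ)) :
    periodicCLM hT l F ⟨0, left_mem_Icc.2 hT⟩ = periodicCLM hT l F ⟨T, right_mem_Icc.2 hT⟩ := by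
  have h : (1 - Complex.exp (l * T)) ≠ 0 := sub_ne_zero.2 hl.symm
  simp only [periodicCLM_apply, ContinuousMap.add_apply, duhamelCLM_left, ← endpointCLM_apply,
    ContinuousMap.smul_apply, smul_eq_mul, expMap, ContinuousMap.coe_mk, Complex.ofReal_zero,
    mul_zero, Complex.exp_zero]
  field_simp
  ring

/-! ### Fourier integrals of cubic trigonometric polynomials -/

theorem integral_cos_mul_trig (a b d e : ℝ) :
    ∫ x in (0 : ℝ)..(2 * Real.pi), Real.cos x * (a * Real.cos x + b * Real.sin x +
      d * (Real.sin x ^ 2 * Real.cos x) + e * (Real.sin x * Real.cos x ^ 2)) =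
      Real.pi * (a + d / 4) := by
  -- The `d` term is the primitive `x / 8 - sin (4 x) / 32` of `sin² cos²`, with `sin (4 x)`
  -- expanded.
  have h : ∀ x : ℝ, HasDerivAt (fun x => a * ((x + Real.sin x * Real.cos x) / 2) +
      b * (Real.sin x ^ 2 / 2) +
      d * ((x - Real.sin x * Real.cos x * (Real.cos x ^ 2 - Real.sin x ^ 2)) / 8) -
      e * (Real.cos x ^ 4 / 4))
      (Real.cos x * (a * Real.cos x + b * Real.sin x +
      d * (Real.sin x ^ 2 * Real.cos x) + e * (Real.sin x * Real.cos x ^ 2))) x := by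
    intro x
    have hs := Real.hasDerivAt_sin x
    have hc := Real.hasDerivAt_cos x
    refine ((((((hasDerivAt_id x).add (hs.mul hc)).div_const 2).const_mul a).add
      (((hs.pow 2).div_const 2).const_mul b)).add
      ((((hasDerivAt_id x).sub ((hs.mul hc).mul ((hc.pow 2).sub (hs.pow 2)))).div_const
        8).const_mul d)).sub (((hc.pow 4).div_const 4).const_mul e) |>.congr_deriv ?_
    have h1 := Real.sin_sq_add_cos_sq x
    simp only [Pi.sub_apply, Pi.mul_apply, Pi.pow_apply]
    push_cast
    linear_combination (-(a / 2) - d / 8 * (1 + Real.sin x ^ 2 + Real.cos x ^ 2)) * h1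
  rw [intervalIntegral.integral_eq_sub_of_hasDerivAt (fun x _ => h x)
    (Continuous.intervalIntegrable (by fun_prop) _ _)]
  simp
  ring

theorem integral_sin_mul_trig (a b d e : ℝ) :
    ∫ x in (0 : ℝ)..(2 * Real.pi), Real.sin x * (a * Real.cos x + b * Real.sin x +
      d * (Real.sin x ^ 2 * Real.cos x) + e * (Real.sin x * Real.cos x ^ 2)) =
      Real.pi * (b + e / 4) := by
  have h : ∀ x : ℝ, HasDerivAt (fun x => a * (Real.sin x ^ 2 / 2) +
      b * ((x - Real.sin x * Real.cos x) / 2) + d * (Real.sin x ^ 4 / 4) +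
      e * ((x - Real.sin x * Real.cos x * (Real.cos x ^ 2 - Real.sin x ^ 2)) / 8))
      (Real.sin x * (a * Real.cos x + b * Real.sin x +
      d * (Real.sin x ^ 2 * Real.cos x) + e * (Real.sin x * Real.cos x ^ 2))) x := by
    intro x
    have hs := Real.hasDerivAt_sin x
    have hc := Real.hasDerivAt_cos x
    refine ((((((hs.pow 2).div_const 2).const_mul a).add
      ((((hasDerivAt_id x).sub (hs.mul hc)).div_const 2).const_mul b)).add
      (((hs.pow 4).div_const 4).const_mul d)).add
      ((((hasDerivAt_id x).sub ((hs.mul hc).mul ((hc.pow 2).sub (hs.pow 2)))).div_const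
        8).const_mul e)).congr_deriv ?_
    have h1 := Real.sin_sq_add_cos_sq x
    simp only [Pi.sub_apply, Pi.mul_apply, Pi.pow_apply]
    push_cast
    linear_combination (-(b / 2) - e / 8 * (1 + Real.sin x ^ 2 + Real.cos x ^ 2)) * h1
  rw [intervalIntegral.integral_eq_sub_of_hasDerivAt (fun x _ => h x)
    (Continuous.intervalIntegrable (by fun_prop) _ _)]
  simp
  ring

/-! ### Frequencies, resonance and nonresonance -/

theorem fastFreq_pos : 0 < fastFreq := Real.sqrt_pos.2 (by positivity)

theorem fastFreq_sq : fastFreq ^ 2 = 2 + √2 := Real.sq_sqrt (by positivity)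

theorem fastPeriod_pos : 0 < fastPeriod := div_pos (by positivity) fastFreq_pos

theorem fastFreq_mul_fastPeriod : fastFreq * fastPeriod = 2 * Real.pi :=
  mul_div_cancel₀ _ fastFreq_pos.ne'

/-- The smaller frequency of the unperturbed double pendulum. -/
noncomputable def slowFreq : ℝ := √(2 - √2)

theorem sqrt_two_lt_two : √2 < 2 := by
  rw [Real.sqrt_lt' (by norm_num)]; norm_num

theorem slowFreq_pos : 0 < slowFreq := Real.sqrt_pos.2 (sub_pos.2 sqrt_two_lt_two)

theorem slowFreq_sq : slowFreq ^ 2 = 2 - √2 := Real.sq_sqrt (sub_pos.2 sqrt_two_lt_two).le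

theorem slowFreq_lt_fastFreq : slowFreq < fastFreq := by
  have : 0 < √2 := by positivity
  exact Real.sqrt_lt_sqrt (sub_pos.2 sqrt_two_lt_two).le (by linarith)

theorem exp_fast_mul_period : Complex.exp (Complex.I * fastFreq * fastPeriod) = 1 := by
  rw [mul_assoc, ← Complex.ofReal_mul, fastFreq_mul_fastPeriod, mul_comm]
  simp

/-- Resonance would make the slow frequency an integer multiple of the fast one, impossible for a
number strictly between `0` and the fast frequency. -/
theorem exp_slow_mul_period_ne_one :
    Complex.exp (Complex.I * slowFreq * fastPeriod) ≠ 1 := by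
  intro h
  obtain ⟨n, hn⟩ := Complex.exp_eq_one_iff.1 h
  have h1 : slowFreq * fastPeriod = n * (2 * Real.pi) := by
    have : Complex.I * ((slowFreq * fastPeriod : ℝ) : ℂ) =
        Complex.I * ((n * (2 * Real.pi) : ℝ) : ℂ) := by
      push_cast
      linear_combination hn
    exact_mod_cast mul_left_cancel₀ Complex.I_ne_zero this
  rw [← fastFreq_mul_fastPeriod, ← mul_assoc] at h1
  have h2 : slowFreq = n * fastFreq := mul_right_cancel₀ fastPeriod_pos.ne' h1
  have h3 := slowFreq_pos
  have h4 := slowFreq_lt_fastFreq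
  have h5 := fastFreq_pos
  have h6 : (0 : ℝ) < n := by
    by_contra! h
    nlinarith
  have h7 : (n : ℝ) < 1 := by
    by_contra! h
    nlinarith
  have h8 : (0 : ℤ) < n := by exact_mod_cast h6
  have h9 : n < (1 : ℤ) := by exact_mod_cast h7
  omega

/-- As `exp (i ω T₂) = 1`, the endpoint value is the Fourier integral of `F` at frequency `ω`. This
family of `F` contains both the forcing along the limit mode and its linearization in fast
directions. -/
theorem endpointCLM_fast_of_trig {F : C(Icc 0 fastPeriod, ℂ)} {a b d e : ℝ}
    (hF : ∀ t : Icc 0 fastPeriod, F t = ((a * Real.cos (fastFreq * t) +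
      b * Real.sin (fastFreq * t) +
      d * (Real.sin (fastFreq * t) ^ 2 * Real.cos (fastFreq * t)) +
      e * (Real.sin (fastFreq * t) * Real.cos (fastFreq * t) ^ 2) : ℝ) : ℂ)) :
    endpointCLM fastPeriod_pos.le (Complex.I * fastFreq) F =
      ((fastFreq⁻¹ * (Real.pi * (a + d / 4)) : ℝ) : ℂ) -
        Complex.I * ((fastFreq⁻¹ * (Real.pi * (b + e / 4)) : ℝ) : ℂ) := by
  let g : ℝ → ℝ := fun x => a * Real.cos x + b * Real.sin x +
      d * (Real.sin x ^ 2 * Real.cos x) + e * (Real.sin x * Real.cos x ^ 2)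
  have hg : Continuous g := by fun_prop
  rw [endpointCLM_apply, duhamelCLM_apply]
  simp only [exp_fast_mul_period, one_mul]
  have h1 : ∫ s in (0 : ℝ)..fastPeriod, Complex.exp (-(Complex.I * fastFreq) * s) *
        F (projIcc 0 fastPeriod fastPeriod_pos.le s) =
      ∫ s in (0 : ℝ)..fastPeriod,
        (((Real.cos (fastFreq * s) * g (fastFreq * s) : ℝ) : ℂ) -
          Complex.I * ((Real.sin (fastFreq * s) * g (fastFreq * s) : ℝ) : ℂ)) := by
    refine intervalIntegral.integral_congr fun s hs => ?_
    rw [uIcc_of_le fastPeriod_pos.le] at hs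
    simp only [projIcc_of_mem fastPeriod_pos.le hs, hF, g]
    have : -(Complex.I * fastFreq) * s = ((-(fastFreq * s) : ℝ) : ℂ) * Complex.I := by
      push_cast; ring
    rw [this, Complex.exp_mul_I, ← Complex.ofReal_cos, ← Complex.ofReal_sin, Real.cos_neg,
      Real.sin_neg]
    push_cast
    ring
  rw [h1, intervalIntegral.integral_sub
    (Continuous.intervalIntegrable (by fun_prop) _ _)
    (Continuous.intervalIntegrable (by fun_prop) _ _),
    intervalIntegral.integral_const_mul, intervalIntegral.integral_ofReal,
    intervalIntegral.integral_ofReal,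
    intervalIntegral.integral_comp_mul_left (fun x => Real.cos x * g x) fastFreq_pos.ne',
    intervalIntegral.integral_comp_mul_left (fun x => Real.sin x * g x) fastFreq_pos.ne',
    mul_zero, fastFreq_mul_fastPeriod, integral_cos_mul_trig, integral_sin_mul_trig]
  simp only [smul_eq_mul]

/-! ### Modal coordinates -/

/-- The perturbation `√2 F₁` in the modal coordinates `z = u' + i ω u`, `y = v' + i μ v`, where
`u = √2 θ₁ - θ₂` and `v = √2 θ₁ + θ₂`. -/
noncomputable def modalForcing (t : ℝ) (x : ℂ × ℂ) : ℝ :=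
  √2 / 2 * (x.2.re - x.1.re) +
    (x.1.im / fastFreq + x.2.im / slowFreq) ^ 2 * (√2 / 8 * Real.cos (fastFreq * t))

/-- The first angle in modal coordinates. -/
noncomputable def angle₁ (x : ℂ × ℂ) : ℝ :=
  (x.1.im / fastFreq + x.2.im / slowFreq) / (2 * √2)

/-- The second angle in modal coordinates. -/
noncomputable def angle₂ (x : ℂ × ℂ) : ℝ :=
  (x.2.im / slowFreq - x.1.im / fastFreq) / 2

/-- The first angular velocity in modal coordinates. -/
noncomputable def velocity₁ (x : ℂ × ℂ) : ℝ := (x.1.re + x.2.re) / (2 * √2)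

/-- The second angular velocity in modal coordinates. -/
noncomputable def velocity₂ (x : ℂ × ℂ) : ℝ := (x.2.re - x.1.re) / 2

/-- The curve `x` solves the double pendulum equations in modal coordinates. -/
def IsModalSolution (ε : ℝ) (x : ℝ → ℂ × ℂ) : Prop :=
  (∀ t, HasDerivAt (fun t => (x t).1)
    (Complex.I * fastFreq * (x t).1 + ((ε * modalForcing t (x t) : ℝ) : ℂ)) t) ∧
  ∀ t, HasDerivAt (fun t => (x t).2)
    (Complex.I * slowFreq * (x t).2 + ((ε * modalForcing t (x t) : ℝ) : ℂ)) t

theorem sqrt_two_mul_pertF₁ (t : ℝ) (x : ℂ × ℂ) :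
    √2 * pertF₁ t (angle₁ x) (velocity₁ x) (angle₂ x) (velocity₂ x) = modalForcing t x := by
  have h2 : √2 ≠ 0 := by positivity
  have h2' : √2 ^ 2 = 2 := Real.sq_sqrt (by norm_num)
  simp only [pertF₁, angle₁, velocity₂, modalForcing, fastFreq]
  rw [div_pow, mul_pow, h2']
  ring

namespace IsModalSolution

variable {ε : ℝ} {x : ℝ → ℂ × ℂ}

theorem hasDerivAt_re_im_fst (h : IsModalSolution ε x) (t : ℝ) :
    HasDerivAt (fun t => (x t).1.re) (-fastFreq * (x t).1.im + ε * modalForcing t (x t)) t ∧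
      HasDerivAt (fun t => (x t).1.im) (fastFreq * (x t).1.re) t := by
  constructor
  · exact (Complex.reCLM.hasFDerivAt.comp_hasDerivAt t (h.1 t)).congr_deriv
      (by simp [-Complex.ofReal_mul])
  · exact (Complex.imCLM.hasFDerivAt.comp_hasDerivAt t (h.1 t)).congr_deriv
      (by simp [-Complex.ofReal_mul])

theorem hasDerivAt_re_im_snd (h : IsModalSolution ε x) (t : ℝ) :
    HasDerivAt (fun t => (x t).2.re) (-slowFreq * (x t).2.im + ε * modalForcing t (x t)) t ∧
      HasDerivAt (fun t => (x t).2.im) (slowFreq * (x t).2.re) t := by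
  constructor
  · exact (Complex.reCLM.hasFDerivAt.comp_hasDerivAt t (h.2 t)).congr_deriv
      (by simp [-Complex.ofReal_mul])
  · exact (Complex.imCLM.hasFDerivAt.comp_hasDerivAt t (h.2 t)).congr_deriv
      (by simp [-Complex.ofReal_mul])

theorem hasDerivAt_angle₁ (h : IsModalSolution ε x) (t : ℝ) :
    HasDerivAt (fun t => angle₁ (x t)) (velocity₁ (x t)) t := by
  refine ((((h.hasDerivAt_re_im_fst t).2.div_const fastFreq).add
    ((h.hasDerivAt_re_im_snd t).2.div_const slowFreq)).div_const (2 * √2)).congr_deriv ?_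
  rw [mul_div_cancel_left₀ _ fastFreq_pos.ne', mul_div_cancel_left₀ _ slowFreq_pos.ne', velocity₁]

theorem hasDerivAt_angle₂ (h : IsModalSolution ε x) (t : ℝ) :
    HasDerivAt (fun t => angle₂ (x t)) (velocity₂ (x t)) t := by
  refine ((((h.hasDerivAt_re_im_snd t).2.div_const slowFreq).sub
    ((h.hasDerivAt_re_im_fst t).2.div_const fastFreq)).div_const 2).congr_deriv ?_
  rw [mul_div_cancel_left₀ _ fastFreq_pos.ne', mul_div_cancel_left₀ _ slowFreq_pos.ne', velocity₂]

theorem deriv_angle₁ (h : IsModalSolution ε x) :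
    deriv (fun t => angle₁ (x t)) = fun t => velocity₁ (x t) :=
  funext fun t => (h.hasDerivAt_angle₁ t).deriv

theorem deriv_angle₂ (h : IsModalSolution ε x) :
    deriv (fun t => angle₂ (x t)) = fun t => velocity₂ (x t) :=
  funext fun t => (h.hasDerivAt_angle₂ t).deriv

/-- The two modal equations carry the same forcing because `F₂ = 0`: it cancels in `v - u = 2 θ₂`
and doubles in `u + v = 2 √2 θ₁`. -/
theorem isSolution (h : IsModalSolution ε x) :
    IsSolution pertF₁ pertF₂ ε (fun t => angle₁ (x t)) (fun t => angle₂ (x t)) := by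
  have h2 : √2 ≠ 0 := by positivity
  have h2' : √2 ^ 2 = 2 := Real.sq_sqrt (by norm_num)
  have hω := fastFreq_pos.ne'
  have hμ := slowFreq_pos.ne'
  have hu : ∀ t, fastFreq * (x t).1.im = (2 + √2) * ((x t).1.im / fastFreq) := fun t => by
    rw [← fastFreq_sq]; field_simp
  have hv : ∀ t, slowFreq * (x t).2.im = (2 - √2) * ((x t).2.im / slowFreq) := fun t => by
    rw [← slowFreq_sq]; field_simp
  refine ⟨fun t => (h.hasDerivAt_angle₁ t).differentiableAt,
    fun t => (h.hasDerivAt_angle₂ t).differentiableAt, fun t => ?_, fun t => ?_⟩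
  · rw [h.deriv_angle₁, h.deriv_angle₂]
    refine (((h.hasDerivAt_re_im_fst t).1.add (h.hasDerivAt_re_im_snd t).1).div_const
      (2 * √2)).congr_deriv ?_
    rw [← sqrt_two_mul_pertF₁, neg_mul, neg_mul, hu, hv]
    generalize pertF₁ t _ _ _ _ = p
    simp only [angle₁, angle₂]
    generalize (x t).1.im / fastFreq = u
    generalize (x t).2.im / slowFreq = v
    field_simp
    ring
  · rw [h.deriv_angle₂]
    refine (((h.hasDerivAt_re_im_snd t).1.sub (h.hasDerivAt_re_im_fst t).1).div_const
      2).congr_deriv ?_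
    rw [neg_mul, neg_mul, hu, hv]
    simp only [angle₁, angle₂, pertF₂]
    generalize (x t).1.im / fastFreq = u
    generalize (x t).2.im / slowFreq = v
    field_simp
    linear_combination (u + v) * h2'

end IsModalSolution

/-! ### The unperturbed limit orbit -/

/-- The fast mode `z = 16 ω² exp (i ω t)`, `y = 0` in modal coordinates. -/
noncomputable def limitMode (t : ℝ) : ℂ × ℂ :=
  (((16 * fastFreq ^ 2 : ℝ) : ℂ) * Complex.exp (Complex.I * fastFreq * t), 0)

theorem limitMode_fst (t : ℝ) : (limitMode t).1 =
    ((16 * fastFreq ^ 2 * Real.cos (fastFreq * t) : ℝ) : ℂ) +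
      ((16 * fastFreq ^ 2 * Real.sin (fastFreq * t) : ℝ) : ℂ) * Complex.I := by
  have : Complex.I * fastFreq * t = ((fastFreq * t : ℝ) : ℂ) * Complex.I := by push_cast; ring
  rw [limitMode, this, Complex.exp_mul_I, ← Complex.ofReal_cos, ← Complex.ofReal_sin]
  push_cast
  ring

theorem isModalSolution_limitMode : IsModalSolution 0 limitMode := by
  constructor
  · intro t
    refine ((((HasDerivAt.ofReal_comp (hasDerivAt_id t)).const_mul
      (Complex.I * fastFreq)).cexp).const_mul ((16 * fastFreq ^ 2 : ℝ) : ℂ)).congr_deriv ?_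
    simp [limitMode]
    ring
  · intro t
    simpa [limitMode] using hasDerivAt_const t (0 : ℂ)

theorem periodic_limitMode : Function.Periodic limitMode fastPeriod := fun t => by
  simp only [limitMode, Complex.ofReal_add, mul_add, Complex.exp_add, exp_fast_mul_period, mul_one]

theorem fastOrbit₁_eq : fastOrbit₁ 0 (-8 * (2 + √2)) = fun t => angle₁ (limitMode t) := by
  have h2 : √2 ≠ 0 := by positivity
  have hω := fastFreq_pos.ne'
  have h4 : √(4 + 2 * √2) = √2 * fastFreq := by
    rw [fastFreq, ← Real.sqrt_mul (by norm_num)]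
    ring_nf
  funext t
  rw [fastOrbit₁, h4, ← fastFreq_sq, angle₁, limitMode_fst]
  simp [limitMode, -Complex.ofReal_mul]
  field_simp
  ring

theorem fastOrbit₂_eq : fastOrbit₂ 0 (-8 * (2 + √2)) = fun t => angle₂ (limitMode t) := by
  have hω := fastFreq_pos.ne'
  funext t
  rw [fastOrbit₂, ← fastFreq_sq, Real.sqrt_sq fastFreq_pos.le, angle₂, limitMode_fst]
  simp [limitMode, -Complex.ofReal_mul]
  field_simp
  ring

/-! ### The forcing operator and its average -/

/-- Continuous functions from the period interval to the complex numbers. -/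
abbrev PeriodMap : Type := C(Icc 0 fastPeriod, ℂ)

/-- The real part of complex valued functions. -/
noncomputable def reMap : PeriodMap →L[ℝ] C(Icc 0 fastPeriod, ℝ) :=
  Complex.reCLM.compLeftContinuous ℝ _

/-- The imaginary part of complex valued functions. -/
noncomputable def imMap : PeriodMap →L[ℝ] C(Icc 0 fastPeriod, ℝ) :=
  Complex.imCLM.compLeftContinuous ℝ _

/-- The inclusion of the real valued functions. -/
noncomputable def ofRealMap : C(Icc 0 fastPeriod, ℝ) →L[ℝ] PeriodMap :=
  Complex.ofRealCLM.compLeftContinuous ℝ _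

/-- The linear part of the modal forcing. -/
noncomputable def forcingLinear : PeriodMap × PeriodMap →L[ℝ] C(Icc 0 fastPeriod, ℝ) :=
  (√2 / 2) • (reMap.comp (ContinuousLinearMap.snd ℝ _ _) -
    reMap.comp (ContinuousLinearMap.fst ℝ _ _))

/-- The linear form whose square appears in the modal forcing. -/
noncomputable def forcingRoot : PeriodMap × PeriodMap →L[ℝ] C(Icc 0 fastPeriod, ℝ) :=
  fastFreq⁻¹ • imMap.comp (ContinuousLinearMap.fst ℝ _ _) +
    slowFreq⁻¹ • imMap.comp (ContinuousLinearMap.snd ℝ _ _)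

/-- The weight of the quadratic part of the modal forcing. -/
noncomputable def forcingWeight : C(Icc 0 fastPeriod, ℝ) :=
  ⟨fun t => √2 / 8 * Real.cos (fastFreq * t), by fun_prop⟩

/-- The modal forcing as a nonlinear operator. -/
noncomputable def forcingMap (x : PeriodMap × PeriodMap) : PeriodMap :=
  ofRealMap (forcingLinear x + forcingRoot x ^ 2 * forcingWeight)

theorem forcingMap_apply (x : PeriodMap × PeriodMap) (t : Icc 0 fastPeriod) :
    forcingMap x t = ((modalForcing t (x.1 t, x.2 t) : ℝ) : ℂ) := by
  change ((√2 / 2 * ((x.2 t).re - (x.1 t).re) + (fastFreq⁻¹ * (x.1 t).im +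
    slowFreq⁻¹ * (x.2 t).im) ^ 2 * (√2 / 8 * Real.cos (fastFreq * t)) : ℝ) : ℂ) = _
  simp only [modalForcing, div_eq_inv_mul]

/-- The forcing is a linear map plus a weighted square in the Banach algebra of continuous
functions, hence strictly differentiable. -/
theorem exists_hasStrictFDerivAt_forcingMap (x : PeriodMap × PeriodMap) :
    ∃ N' : PeriodMap × PeriodMap →L[ℝ] PeriodMap, HasStrictFDerivAt forcingMap N' x ∧
      ∀ h (t : Icc 0 fastPeriod), N' h t = ((√2 / 2 * ((h.2 t).re - (h.1 t).re) +
        2 * ((x.1 t).im / fastFreq + (x.2 t).im / slowFreq) *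
          ((h.1 t).im / fastFreq + (h.2 t).im / slowFreq) *
            (√2 / 8 * Real.cos (fastFreq * t)) : ℝ) : ℂ) := by
  have h1 := forcingLinear.hasStrictFDerivAt (x := x)
  have h2 := ((forcingRoot.hasStrictFDerivAt (x := x)).pow 2).mul_const forcingWeight
  refine ⟨_, ofRealMap.hasStrictFDerivAt.comp x (h1.fun_add h2), fun h t => ?_⟩
  have e1 : forcingLinear h t = √2 / 2 * ((h.2 t).re - (h.1 t).re) := rfl
  have e2 : ∀ h : PeriodMap × PeriodMap,
      forcingRoot h t = (h.1 t).im / fastFreq + (h.2 t).im / slowFreq := fun h => by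
    rw [div_eq_inv_mul, div_eq_inv_mul]; rfl
  have e3 : forcingWeight t = √2 / 8 * Real.cos (fastFreq * t) := rfl
  rw [← e1, ← e2, ← e2, ← e3]
  change ((_ : ℝ) : ℂ) = _
  congr 1
  have e4 : (2 : C(Icc 0 fastPeriod, ℝ)) t = 2 := rfl
  simp [e4]
  ring

theorem modeCLM_fast_apply (c : ℂ) (t : Icc 0 fastPeriod) :
    modeCLM fastPeriod (Complex.I * fastFreq) c t =
      ((c.re * Real.cos (fastFreq * t) - c.im * Real.sin (fastFreq * t) : ℝ) : ℂ) +
      ((c.re * Real.sin (fastFreq * t) + c.im * Real.cos (fastFreq * t) : ℝ) : ℂ) * Complex.I := by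
  have : Complex.I * fastFreq * (t : ℝ) = ((fastFreq * t : ℝ) : ℂ) * Complex.I := by
    push_cast; ring
  change c * Complex.exp (Complex.I * fastFreq * (t : ℝ)) = _
  rw [this, Complex.exp_mul_I, ← Complex.ofReal_cos, ← Complex.ofReal_sin]
  apply Complex.ext <;> simp [-Complex.ofReal_cos, -Complex.ofReal_sin, -Complex.ofReal_mul]

/-- The fast mode with complex amplitude `c`, as an element of the state space. -/
noncomputable def fastMode : ℂ →L[ℝ] PeriodMap × PeriodMap :=
  (modeCLM fastPeriod (Complex.I * fastFreq)).prod 0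

/-- The amplitude of the limit mode. -/
noncomputable def limitAmplitude : ℂ := ((16 * fastFreq ^ 2 : ℝ) : ℂ)

theorem endpointCLM_forcingMap_limit :
    endpointCLM fastPeriod_pos.le (Complex.I * fastFreq)
      (forcingMap (fastMode limitAmplitude)) = 0 := by
  -- For a real amplitude `A`, `a = -√2 A / 2` and `d = √2 A² / (8 ω²)`. The condition `a + d / 4 =
  -- 0` with `A ≠ 0` gives exactly `A = 16 ω²`.
  rw [endpointCLM_fast_of_trig (a := -(√2 / 2 * (16 * fastFreq ^ 2))) (b := 0)
    (d := 4 * (√2 / 2 * (16 * fastFreq ^ 2))) (e := 0)]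
  · simp
  · intro t
    have hω := fastFreq_pos.ne'
    rw [forcingMap_apply]
    congr 1
    simp only [modalForcing, fastMode, ContinuousLinearMap.prod_apply, modeCLM_fast_apply,
      limitAmplitude, zero_apply, ContinuousMap.zero_apply]
    simp [-Complex.ofReal_mul, -Complex.ofReal_pow]
    field_simp
    ring

theorem bijective_average {N' : PeriodMap × PeriodMap →L[ℝ] PeriodMap}
    (hN' : ∀ h (t : Icc 0 fastPeriod), N' h t = ((√2 / 2 * ((h.2 t).re - (h.1 t).re) +
        2 * (((fastMode limitAmplitude).1 t).im / fastFreq +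
          ((fastMode limitAmplitude).2 t).im / slowFreq) *
          ((h.1 t).im / fastFreq + (h.2 t).im / slowFreq) *
            (√2 / 8 * Real.cos (fastFreq * t)) : ℝ) : ℂ)) :
    Function.Bijective (fun c =>
      endpointCLM fastPeriod_pos.le (Complex.I * fastFreq) (N' (fastMode c))) := by
  let J : ℂ →ₗ[ℝ] ℂ := ((endpointCLM fastPeriod_pos.le (Complex.I * fastFreq)).comp
    (N'.comp fastMode)).toLinearMap
  have hinj : Function.Injective J := by
    rw [injective_iff_map_eq_zero]
    intro c hc
    have hω := fastFreq_pos.ne'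
    have hc' : endpointCLM fastPeriod_pos.le (Complex.I * fastFreq) (N' (fastMode c)) = 0 := hc
    -- Here `a + d / 4 = (√2 / 2) Re c` and `b + e / 4 = (3 √2 / 2) Im c`: the averaged derivative
    -- is diagonal with nonzero entries.
    rw [endpointCLM_fast_of_trig (a := -(√2 / 2) * c.re) (b := √2 / 2 * c.im)
      (d := 4 * √2 * c.re) (e := 4 * √2 * c.im)] at hc'
    · have h1 := congrArg Complex.re hc'
      have h2 := congrArg Complex.im hc'
      simp [-Complex.ofReal_mul, hω, Real.pi_ne_zero] at h1 h2
      have h3 : √2 ≠ 0 := by positivity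
      apply Complex.ext
      · exact mul_left_cancel₀ h3 (by simp only [Complex.zero_re]; linarith)
      · exact mul_left_cancel₀ h3 (by simp only [Complex.zero_im]; linarith)
    · intro t
      rw [hN']
      congr 1
      simp only [fastMode, ContinuousLinearMap.prod_apply, modeCLM_fast_apply,
        limitAmplitude, zero_apply, ContinuousMap.zero_apply]
      simp [-Complex.ofReal_mul, -Complex.ofReal_pow]
      field_simp
      ring
  exact ⟨hinj, LinearMap.injective_iff_surjective.1 hinj⟩

/-! ### The branch of periodic solutions -/

theorem exists_modal_branch : ∃ x : ℝ → ℝ → ℂ × ℂ,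
    TendstoUniformly x limitMode (𝓝 0) ∧
    ∀ᶠ ε in 𝓝 (0 : ℝ), IsModalSolution ε (x ε) ∧ Function.Periodic (x ε) fastPeriod := by
  have hT := fastPeriod_pos
  obtain ⟨N', hN, hN'⟩ := exists_hasStrictFDerivAt_forcingMap (fastMode limitAmplitude)
  obtain ⟨c, x, hx, hxe⟩ := exists_branch_of_bijective_average fastMode
    ((duhamelCLM hT.le (Complex.I * fastFreq)).prod (periodicCLM hT.le (Complex.I * slowFreq)))
    (endpointCLM hT.le (Complex.I * fastFreq)) hN endpointCLM_forcingMap_limit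
    (bijective_average hN')
  refine ⟨fun ε t => (periodicExtension hT (x ε).1 t, periodicExtension hT (x ε).2 t), ?_, ?_⟩
  · have hl : limitMode = fun t => (periodicExtension hT (fastMode limitAmplitude).1 t,
        periodicExtension hT (fastMode limitAmplitude).2 t) := by
      refine eq_of_periodic_of_eqOn_Ico hT periodic_limitMode (fun t => ?_) fun t ht => ?_
      · rw [periodic_periodicExtension, periodic_periodicExtension]
      · rw [periodicExtension_of_mem_Ico hT _ ht, periodicExtension_of_mem_Ico hT _ ht]
        rfl
    rw [hl, Metric.tendstoUniformly_iff]
    intro r hr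
    filter_upwards [Metric.tendsto_nhds.1 hx r hr] with ε hε t
    rw [dist_comm] at hε
    rw [Prod.dist_eq] at hε ⊢
    exact max_lt ((ContinuousMap.dist_apply_le_dist _).trans_lt (lt_of_le_of_lt (le_max_left _ _) hε))
      ((ContinuousMap.dist_apply_le_dist _).trans_lt (lt_of_le_of_lt (le_max_right _ _) hε))
  · filter_upwards [hxe] with ε ⟨hε, hR⟩
    have hperiodic : Function.Periodic (fun t => (periodicExtension hT (x ε).1 t,
        periodicExtension hT (x ε).2 t)) fastPeriod := fun t => by
      beta_reduce
      rw [periodic_periodicExtension, periodic_periodicExtension]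
    refine ⟨?_, hperiodic⟩
    have h1 : (x ε).1 = c ε • expMap fastPeriod (Complex.I * fastFreq) +
        duhamelCLM hT.le (Complex.I * fastFreq) (ε • forcingMap (x ε)) := by
      rw [map_smul]
      exact congrArg Prod.fst hε
    have h2 : (x ε).2 = periodicCLM hT.le (Complex.I * slowFreq) (ε • forcingMap (x ε)) := by
      rw [map_smul]
      exact (congrArg Prod.snd hε).trans (zero_add _)
    have hR' : duhamelCLM hT.le (Complex.I * fastFreq) (ε • forcingMap (x ε))
        ⟨fastPeriod, right_mem_Icc.2 hT.le⟩ = 0 := by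
      rw [← endpointCLM_apply, map_smul, hR, smul_zero]
    have hz : (x ε).1 ⟨0, left_mem_Icc.2 hT.le⟩ =
        (x ε).1 ⟨fastPeriod, right_mem_Icc.2 hT.le⟩ := by
      rw [h1, ContinuousMap.add_apply, ContinuousMap.add_apply, duhamelCLM_left, hR']
      simp [expMap, exp_fast_mul_period]
    have hy : (x ε).2 ⟨0, left_mem_Icc.2 hT.le⟩ =
        (x ε).2 ⟨fastPeriod, right_mem_Icc.2 hT.le⟩ := by
      rw [h2]
      exact periodicCLM_left_eq_right hT.le exp_slow_mul_period_ne_one _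
    -- The explicit time dependence also closes up over one period, so the extended forcing is
    -- continuous.
    have hF : (ε • forcingMap (x ε)) ⟨0, left_mem_Icc.2 hT.le⟩ =
        (ε • forcingMap (x ε)) ⟨fastPeriod, right_mem_Icc.2 hT.le⟩ := by
      rw [ContinuousMap.smul_apply, ContinuousMap.smul_apply, forcingMap_apply, forcingMap_apply,
        hz, hy]
      simp only [modalForcing, fastFreq_mul_fastPeriod, mul_zero, Real.cos_zero, Real.cos_two_pi]
    have hG : periodicExtension hT (ε • forcingMap (x ε)) = fun t =>
        ((ε * modalForcing t (periodicExtension hT (x ε).1 t,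
          periodicExtension hT (x ε).2 t) : ℝ) : ℂ) := by
      refine eq_of_periodic_of_eqOn_Ico hT (periodic_periodicExtension hT _)
        (fun t => ?_) fun t ht => ?_
      · rw [periodic_periodicExtension, periodic_periodicExtension]
        simp only [modalForcing, mul_add, fastFreq_mul_fastPeriod, Real.cos_add_two_pi]
      · simp only [periodicExtension_of_mem_Ico hT _ ht]
        rw [ContinuousMap.smul_apply, forcingMap_apply, Complex.ofReal_mul]
        rfl
    constructor
    · intro t
      have := hasDerivAt_periodicExtension hT h1 hz hF t
      rwa [hG] at this
    · intro t
      have := hasDerivAt_periodicExtension hT (h2.trans (periodicCLM_apply _ _ _)) hy hF t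
      rwa [hG] at this

end DoublePendulum

theorem corollary2 :
    -- the limit is a periodic solution of the unperturbed double pendulum
    (DoublePendulum.IsSolution DoublePendulum.pertF₁ DoublePendulum.pertF₂ 0
        (DoublePendulum.fastOrbit₁ 0 (-8 * (2 + √2)))
        (DoublePendulum.fastOrbit₂ 0 (-8 * (2 + √2))) ∧
      Function.Periodic (DoublePendulum.fastOrbit₁ 0 (-8 * (2 + √2))) DoublePendulum.fastPeriod ∧
      Function.Periodic (DoublePendulum.fastOrbit₂ 0 (-8 * (2 + √2))) DoublePendulum.fastPeriod) ∧
    -- it persists for all small nonzero values of the parameter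
    ∃ ε₀ : ℝ, 0 < ε₀ ∧ ∃ θ₁ θ₂ : ℝ → ℝ → ℝ,
      (∀ ε : ℝ, ε ≠ 0 → |ε| < ε₀ →
        DoublePendulum.IsSolution DoublePendulum.pertF₁ DoublePendulum.pertF₂ ε (θ₁ ε) (θ₂ ε) ∧
        Function.Periodic (θ₁ ε) DoublePendulum.fastPeriod ∧
        Function.Periodic (θ₂ ε) DoublePendulum.fastPeriod) ∧
      TendstoUniformly θ₁ (DoublePendulum.fastOrbit₁ 0 (-8 * (2 + √2))) (𝓝[≠] (0 : ℝ)) ∧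
      TendstoUniformly θ₂ (DoublePendulum.fastOrbit₂ 0 (-8 * (2 + √2))) (𝓝[≠] (0 : ℝ)) ∧
      TendstoUniformly (fun ε => deriv (θ₁ ε))
        (deriv (DoublePendulum.fastOrbit₁ 0 (-8 * (2 + √2)))) (𝓝[≠] (0 : ℝ)) ∧
      TendstoUniformly (fun ε => deriv (θ₂ ε))
        (deriv (DoublePendulum.fastOrbit₂ 0 (-8 * (2 + √2)))) (𝓝[≠] (0 : ℝ)) := by
  open DoublePendulum Filter in
  obtain ⟨x, hx, hxe⟩ := exists_modal_branch
  obtain ⟨ε₀, hε₀, hball⟩ := Metric.eventually_nhds_iff.1 hxe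
  have hlim := isModalSolution_limitMode
  -- Angles and velocities are continuous real-linear functionals of the modal state, so all four
  -- limits follow from this.
  have uniform : ∀ φ : (ℂ × ℂ) →L[ℝ] ℝ, TendstoUniformly (fun ε t => φ (x ε t))
      (fun t => φ (limitMode t)) (𝓝[≠] (0 : ℝ)) := fun φ u hu =>
    nhdsWithin_le_nhds (φ.uniformContinuous.comp_tendstoUniformly hx u hu)
  let z := ContinuousLinearMap.fst ℝ ℂ ℂ
  let y := ContinuousLinearMap.snd ℝ ℂ ℂ
  have e : ∀ᶠ ε in 𝓝[≠] (0 : ℝ), IsModalSolution ε (x ε) :=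
    nhdsWithin_le_nhds (hxe.mono fun _ h => h.1)
  rw [fastOrbit₁_eq, fastOrbit₂_eq, hlim.deriv_angle₁, hlim.deriv_angle₂]
  refine ⟨⟨hlim.isSolution, periodic_limitMode.comp angle₁, periodic_limitMode.comp angle₂⟩,
    ε₀, hε₀, fun ε t => angle₁ (x ε t), fun ε t => angle₂ (x ε t), fun ε _ hε => ?_, ?_, ?_, ?_, ?_⟩
  · obtain ⟨h, hp⟩ := hball (by simpa using hε)
    exact ⟨h.isSolution, hp.comp angle₁, hp.comp angle₂⟩
  · convert uniform ((2 * √2)⁻¹ • (fastFreq⁻¹ • Complex.imCLM.comp z +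
      slowFreq⁻¹ • Complex.imCLM.comp y)) using 3 <;>
    simp [angle₁, z, y] <;> ring
  · convert uniform ((2 : ℝ)⁻¹ • (slowFreq⁻¹ • Complex.imCLM.comp y -
      fastFreq⁻¹ • Complex.imCLM.comp z)) using 3 <;>
    simp [angle₂, z, y] <;> ring
  · have hv : TendstoUniformly (fun ε t => velocity₁ (x ε t))
        (fun t => velocity₁ (limitMode t)) (𝓝[≠] (0 : ℝ)) := by
      convert uniform ((2 * √2)⁻¹ • (Complex.reCLM.comp z + Complex.reCLM.comp y)) using 3 <;>
      simp [velocity₁, z, y] <;> ring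
    -- The derivative of the angle is known to be the modal velocity only for `ε` near `0`, which
    -- suffices for the limit.
    intro u hu
    filter_upwards [hv u hu, e] with ε h₁ h
    rwa [h.deriv_angle₁]
  · have hv : TendstoUniformly (fun ε t => velocity₂ (x ε t))
        (fun t => velocity₂ (limitMode t)) (𝓝[≠] (0 : ℝ)) := by
      convert uniform ((2 : ℝ)⁻¹ • (Complex.reCLM.comp y - Complex.reCLM.comp z)) using 3 <;>
      simp [velocity₂, z, y] <;> ring
    intro u hu
    filter_upwards [hv u hu, e] with ε h₁ h
    rwa [h.deriv_angle₂]
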